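/- Let $Y=(Y(t))_{t\ge 0}$ be a real-valued Lévy process (started at $0$, with independent stationary increments and càdlàg paths), and let $X$ be a (selfdecomposable) real random variable with the random integral representation $X=\int_0^\infty e^{-s}\,dY(s)$, i.e. $X$ is the limit in distribution, as $T\to\infty$, of the pathwise integrals $\int_{(0,T]}e^{-s}\,dY(s):=e^{-T}Y(T)-Y(0)+\int_0^T Y(s)e^{-s}\,ds$. Let $\phi(t)=\mathbb E[e^{itX}]$, $t\in\mathbb R$, be the characteristic function of $X$, and let $G_X(a)=P(Y(1)\le a)$, $a\in\mathbb R$, be the background driving distribution function of $X$. Then $\phi$ has no zeros and is differentiable at every $t\neq 0$; for every $a\in\mathbb R$ the function $t\mapsto \frac1t\,\Im\exp\bigl[-ita+t\,\phi'(t)/\phi(t)\bigr]$ is Lebesgue integrable on $(0,T]$ for every $T>0$; and at every continuity point $a$ of $G_X$ $$G_X(a)=\frac12-\frac1\pi\int_0^\infty \Im\Bigl(\exp\Bigl[-ita+t\,\frac{\phi'(t)}{\phi(t)}\Bigr]\Bigr)\,\frac{dt}{t},$$ where the integral is the limit of $\int_0^T$ as $T\to\infty$. -/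

import Mathlib

open MeasureTheory ProbabilityTheory Filter Topology
open scoped NNReal

/-- A real-valued Lévy process `(Y t, t ≥ 0)` on the probability space `(Ω, P)`: it starts at `0`,
has independent and stationary increments, and almost all its paths are càdlàg. (Stochastic
continuity is a consequence of these properties.) -/
structure IsLevyProcess {Ω : Type*} [MeasurableSpace Ω] (Y : ℝ≥0 → Ω → ℝ) (P : Measure Ω) :
    Prop where
  measurable : ∀ t, Measurable (Y t)
  zero : ∀ᵐ ω ∂P, Y 0 ω = 0
  indep_increments : HasIndepIncrements Y P
  stationary_increments : ∀ s t : ℝ≥0,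
    IdentDistrib (fun ω => Y (s + t) ω - Y s ω) (fun ω => Y t ω - Y 0 ω) P P
  cadlag : ∀ᵐ ω ∂P, ∀ t : ℝ≥0,
    ContinuousWithinAt (fun s => Y s ω) (Set.Ici t) t ∧
      ∃ l : ℝ, Tendsto (fun s => Y s ω) (𝓝[<] t) (𝓝 l)

/-- The integral `∫_{(0, T]} e^{-s} dy(s)` against a càdlàg path `y`, defined, as is usual for a
continuous integrand `f` of bounded variation, through integration by parts:
`f(T) y(T) - f(0) y(0) - ∫_{(0, T]} y(s) df(s)` with `f(s) = e^{-s}`. -/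
noncomputable def expIntegral (y : ℝ≥0 → ℝ) (T : ℝ≥0) : ℝ :=
  Real.exp (-(T : ℝ)) * y T - y 0 + ∫ s in (0 : ℝ)..(T : ℝ), y s.toNNReal * Real.exp (-s)

/-- `X` has the random integral representation `X = ∫_0^∞ e^{-s} dY(s)` with respect to the Lévy
process `Y` (the background driving Lévy process of `X`): `X` is the limit, as `T → ∞`, of the
integrals `∫_{(0, T]} e^{-s} dY(s)`. Convergence and equality are only required in law, so
that `X` may live on a probability space of its own; almost sure convergence and convergence in
probability (on the space of `Y`) are special cases. -/
structure HasRandomIntegralRepresentation {Ω' Ω : Type*} [MeasurableSpace Ω'] [MeasurableSpace Ω]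
    (X : Ω' → ℝ) (P' : Measure Ω') [IsProbabilityMeasure P']
    (Y : ℝ≥0 → Ω → ℝ) (P : Measure Ω) [IsProbabilityMeasure P] : Prop where
  levy : IsLevyProcess Y P
  tendsto : TendstoInDistribution
    (fun (T : ℝ≥0) ω => expIntegral (fun s => Y s ω) T) atTop X (fun _ => P) P'

/-- The background driving distribution function `G_X(a) = P(Y(1) ≤ a)`. -/
noncomputable def backgroundDrivingDistributionFunction {Ω : Type*} [MeasurableSpace Ω]
    (Y : ℝ≥0 → Ω → ℝ) (P : Measure Ω) (a : ℝ) : ℝ :=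
  P.real {ω | Y 1 ω ≤ a}

/-- The integrand `Im (exp (-ita + t φ'(t)/φ(t))) / t` of the inversion formula. -/
noncomputable def inversionIntegrand (φ : ℝ → ℂ) (a t : ℝ) : ℝ :=
  (Complex.exp (-(Complex.I * t * a) + t * (deriv φ t / φ t))).im / t

/-! The Lévy property gives E exp(iuY(t)) = exp(tη(u)) with η continuous and η(0) = 0. Passing to
the limit in Riemann–Stieltjes sums, the integral over (0,T] has characteristic function exp ∫_0^T
η(e^{-s}u) ds = exp ∫_{e^{-T}u}^u η(v)/v dv. Once η(v)/v is known to be integrable at 0, T → ∞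
yields φ(u) = exp ∫_0^u η(v)/v dv. Hence φ has no zeros, tφ'(t)/φ(t) = η(t) for t ≠ 0, and
exp(tφ'(t)/φ(t)) is the characteristic function of Y(1): the claim is the Gil-Pelaez formula for
Y(1).

Both the integrability of η(v)/v and that of the inversion integrand near 0 rest on E log(1+|Y(1)|)
< ∞. This log moment is extracted from the convergence in law
(`HasRandomIntegralRepresentation.integrable_log`): |φ(ε)| > 0 for some ε > 0 bounds the integrals
of -Re η(v)/v, hence that of (1-|E exp(ivY(1))|²)/v near 0, and
`integrable_log_one_add_abs_of_charFun` turns this into a log moment. The way back to η(v)/v is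
`intervalIntegrable_exponent_div`. -/

/-! ### The Dirichlet integral. -/

theorem integral_exp_neg_mul_sin (t T : ℝ) :
    ∫ x in (0 : ℝ)..T, Real.sin x * Real.exp (-(x * t)) =
      (1 - Real.exp (-(T * t)) * (Real.cos T + t * Real.sin T)) / (1 + t ^ 2) := by
  have hpos : (1 + t ^ 2) ≠ 0 := by positivity
  have key : ∀ x ∈ Set.uIcc 0 T, HasDerivAt
      (fun x => -(Real.exp (-(x * t)) * (Real.cos x + t * Real.sin x)) / (1 + t ^ 2))
      (Real.sin x * Real.exp (-(x * t))) x := by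
    intro x _
    have h1 : HasDerivAt (fun x => Real.exp (-(x * t))) (Real.exp (-(x * t)) * -(1 * t)) x :=
      (((hasDerivAt_id x).mul_const t).neg).exp
    have h2 : HasDerivAt (fun x => Real.cos x + t * Real.sin x)
        (-Real.sin x + t * Real.cos x) x :=
      (Real.hasDerivAt_cos x).add ((Real.hasDerivAt_sin x).const_mul t)
    refine (((h1.mul h2).neg).div_const (1 + t ^ 2)).congr_deriv ?_
    field_simp
    ring
  rw [intervalIntegral.integral_eq_sub_of_hasDerivAt key
    (Continuous.intervalIntegrable (by fun_prop) _ _)]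
  simp
  field_simp
  ring

theorem integrableOn_exp_neg_mul {x : ℝ} (hx : 0 < x) :
    IntegrableOn (fun t => Real.exp (-(x * t))) (Set.Ioi 0) := by
  simpa using integrableOn_exp_mul_Ioi (neg_neg_of_pos hx) 0

theorem integral_exp_neg_mul {x : ℝ} (hx : 0 < x) :
    ∫ t in Set.Ioi (0 : ℝ), Real.exp (-(x * t)) = x⁻¹ := by
  have := integral_exp_mul_Ioi (neg_neg_of_pos hx) 0
  simpa using this

/-- Write 1/x = ∫_0^∞ e^{-xt} dt and swap the integrals; Fubini applies because the inner integral
of the absolute value is |sinc x|, which is bounded. -/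
theorem integral_sinc_eq {T : ℝ} (hT : 0 < T) :
    ∫ x in (0 : ℝ)..T, Real.sinc x = ∫ t in Set.Ioi (0 : ℝ),
      (1 - Real.exp (-(T * t)) * (Real.cos T + t * Real.sin T)) / (1 + t ^ 2) := by
  have hint : Integrable (Function.uncurry fun x t : ℝ => Real.sin x * Real.exp (-(x * t)))
      ((volume.restrict (Set.Ioc 0 T)).prod (volume.restrict (Set.Ioi 0))) := by
    rw [integrable_prod_iff (by fun_prop)]
    constructor
    · filter_upwards [ae_restrict_mem measurableSet_Ioc] with x hx
      exact (integrableOn_exp_neg_mul hx.1).const_mul (Real.sin x)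
    · have : IntegrableOn (fun x => |Real.sinc x|) (Set.Ioc 0 T) :=
        (Real.continuous_sinc.abs).integrableOn_Ioc
      refine this.congr ?_
      filter_upwards [ae_restrict_mem measurableSet_Ioc] with x hx
      simp only [Function.uncurry, norm_mul, Real.norm_eq_abs, Real.abs_exp]
      rw [integral_const_mul, integral_exp_neg_mul hx.1, Real.sinc_of_ne_zero hx.1.ne', abs_div,
        abs_of_pos hx.1, div_eq_mul_inv]
  have := integral_integral_swap hint
  rw [intervalIntegral.integral_of_le hT.le]
  convert this using 1
  · refine setIntegral_congr_fun measurableSet_Ioc fun x hx => ?_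
    rw [integral_const_mul, integral_exp_neg_mul hx.1, Real.sinc_of_ne_zero hx.1.ne',
      div_eq_mul_inv]
  · refine setIntegral_congr_fun measurableSet_Ioi fun t _ => ?_
    rw [← intervalIntegral.integral_of_le hT.le, integral_exp_neg_mul_sin]

/-- The **Dirichlet integral**. -/
theorem tendsto_integral_sinc_atTop :
    Tendsto (fun T : ℝ => ∫ x in (0 : ℝ)..T, Real.sinc x) atTop (𝓝 (Real.pi / 2)) := by
  have h0 : ∫ t in Set.Ioi (0 : ℝ), (1 + t ^ 2)⁻¹ = Real.pi / 2 := by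
    simp
  rw [← h0]
  have hlim : Tendsto (fun T : ℝ => ∫ t in Set.Ioi (0 : ℝ),
      (1 - Real.exp (-(T * t)) * (Real.cos T + t * Real.sin T)) / (1 + t ^ 2)) atTop
      (𝓝 (∫ t in Set.Ioi (0 : ℝ), (1 + t ^ 2)⁻¹)) := by
    -- For T ≥ 1 both e^{-Tt} and t e^{-Tt} are at most 1, so the numerator is at most 1 + 1 + 1.
    refine tendsto_integral_filter_of_dominated_convergence (fun t => 3 * (1 + t ^ 2)⁻¹) ?_ ?_
      ((integrable_inv_one_add_sq.const_mul 3).integrableOn) ?_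
    · refine .of_forall fun T => Continuous.aestronglyMeasurable ?_
      refine Continuous.div (by fun_prop) (by fun_prop) fun t => by positivity
    · filter_upwards [eventually_ge_atTop 1] with T hT
      filter_upwards [ae_restrict_mem measurableSet_Ioi] with t ht
      have ht : 0 < t := ht
      rw [norm_div, div_eq_mul_inv, Real.norm_eq_abs, Real.norm_eq_abs,
        abs_of_pos (show 0 < 1 + t ^ 2 by positivity)]
      gcongr
      have h1 : Real.exp (-(T * t)) ≤ 1 := Real.exp_le_one_iff.2 (by nlinarith)
      have h2 : Real.exp (-(T * t)) * t ≤ 1 := by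
        have h3 : t ≤ Real.exp (T * t) := by
          have := Real.add_one_le_exp (T * t)
          nlinarith
        rw [Real.exp_neg, inv_mul_le_iff₀ (Real.exp_pos _)]
        simpa using h3
      have h4 := Real.exp_pos (-(T * t))
      calc |1 - Real.exp (-(T * t)) * (Real.cos T + t * Real.sin T)|
          ≤ |1| + |Real.exp (-(T * t)) * (Real.cos T + t * Real.sin T)| := abs_sub _ _
        _ ≤ 1 + (Real.exp (-(T * t)) * |Real.cos T| + (Real.exp (-(T * t)) * t) * |Real.sin T|) := by
            rw [abs_one, abs_mul, abs_of_pos h4, mul_assoc, ← mul_add]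
            gcongr
            refine (abs_add_le _ _).trans ?_
            rw [abs_mul, abs_of_pos ht]
        _ ≤ 1 + (1 * 1 + 1 * 1) := by
            gcongr
            · exact Real.abs_cos_le_one T
            · exact Real.abs_sin_le_one T
        _ = 3 := by norm_num
    · filter_upwards [ae_restrict_mem measurableSet_Ioi] with t ht
      have ht : 0 < t := ht
      have h1 : Tendsto (fun T : ℝ => Real.exp (-(T * t))) atTop (𝓝 0) :=
        Real.tendsto_exp_neg_atTop_nhds_zero.comp (tendsto_id.atTop_mul_const ht)
      have h2 : Tendsto (fun T : ℝ => Real.exp (-(T * t)) * (Real.cos T + t * Real.sin T)) atTop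
          (𝓝 0) := by
        refine squeeze_zero_norm (a := fun T => Real.exp (-(T * t)) * (1 + t * 1)) (fun T => ?_)
          (by simpa using h1.mul_const (1 + t * 1))
        rw [norm_mul, Real.norm_eq_abs, Real.abs_exp]
        gcongr
        refine (norm_add_le _ _).trans ?_
        rw [norm_mul, Real.norm_eq_abs, Real.norm_eq_abs, Real.norm_eq_abs, abs_of_pos ht]
        gcongr
        · exact Real.abs_cos_le_one T
        · exact Real.abs_sin_le_one T
      simpa [div_eq_mul_inv] using (h2.const_sub 1).mul_const (1 + t ^ 2)⁻¹
  refine hlim.congr' ?_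
  filter_upwards [eventually_gt_atTop 0] with T hT using (integral_sinc_eq hT).symm

theorem tendsto_integral_sinc_atBot :
    Tendsto (fun T : ℝ => ∫ x in (0 : ℝ)..T, Real.sinc x) atBot (𝓝 (-(Real.pi / 2))) := by
  refine ((tendsto_integral_sinc_atTop.comp tendsto_neg_atBot_atTop).neg).congr fun T => ?_
  have := intervalIntegral.integral_comp_neg (a := 0) (b := T) (fun x => Real.sinc x)
  simp only [Real.sinc_neg, neg_zero] at this
  simp only [Function.comp]
  rw [this, ← intervalIntegral.integral_symm]

theorem continuous_integral_sinc : Continuous fun T : ℝ => ∫ x in (0 : ℝ)..T, Real.sinc x :=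
  intervalIntegral.continuous_primitive (fun _ _ => Real.continuous_sinc.intervalIntegrable _ _) 0

/-- Continuity on a compact interval and finite limits at both ends. The uniform bound is the
dominating constant in the inversion formula. -/
theorem exists_abs_integral_sinc_le : ∃ C, ∀ T : ℝ, |∫ x in (0 : ℝ)..T, Real.sinc x| ≤ C := by
  obtain ⟨a, ha⟩ := eventually_atBot.1 (tendsto_integral_sinc_atBot.norm.eventually_le_const
    (lt_add_one ‖-(Real.pi / 2)‖))
  obtain ⟨b, hb⟩ := eventually_atTop.1 (tendsto_integral_sinc_atTop.norm.eventually_le_const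
    (lt_add_one ‖Real.pi / 2‖))
  obtain ⟨C, hC⟩ := (isCompact_Icc (a := a) (b := b)).exists_bound_of_continuousOn
    continuous_integral_sinc.continuousOn
  refine ⟨max C (‖Real.pi / 2‖ + 1), fun T => ?_⟩
  rcases le_total T a with h | h
  · exact (le_max_right _ _).trans' (by simpa using ha T h)
  rcases le_total b T with h' | h'
  · exact (le_max_right _ _).trans' (hb T h')
  · exact (le_max_left _ _).trans' (hC T ⟨h, h'⟩)

/-! ### Gil-Pelaez inversion under a logarithmic moment. -/

theorem integral_mul_sinc (z T : ℝ) :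
    ∫ t in (0 : ℝ)..T, z * Real.sinc (t * z) = ∫ x in (0 : ℝ)..(T * z), Real.sinc x := by
  simp

/-- The two bounds |z| and 1/t are merged into one expression whose integral over t in [0,T] is
exactly log(1+T|z|); this is how the log moment enters. -/
theorem abs_mul_sinc_le {t : ℝ} (ht : 0 ≤ t) (z : ℝ) :
    |z * Real.sinc (t * z)| ≤ 2 * (|z| / (1 + t * |z|)) := by
  have hz := abs_nonneg z
  have h1 : 0 < 1 + t * |z| := by positivity
  rw [← mul_div_assoc, le_div_iff₀ h1, abs_mul]
  have h2 := Real.abs_sinc_le_one (t * z)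
  have h3 : t * |z| * |Real.sinc (t * z)| ≤ 1 := by
    rcases eq_or_ne (t * z) 0 with h | h
    · have : t * |z| = 0 := by rw [← abs_of_nonneg ht, ← abs_mul, h, abs_zero]
      simp [this]
    · rw [Real.sinc_of_ne_zero h, abs_div, abs_mul, abs_of_nonneg ht]
      have : t * |z| ≠ 0 := by rwa [← abs_of_nonneg ht, ← abs_mul, abs_ne_zero]
      rw [mul_div_cancel₀ _ this]
      exact Real.abs_sin_le_one _
  nlinarith [abs_nonneg (Real.sinc (t * z))]

theorem integral_abs_div_one_add_mul {T : ℝ} (hT : 0 ≤ T) (z : ℝ) :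
    ∫ t in (0 : ℝ)..T, |z| / (1 + t * |z|) = Real.log (1 + T * |z|) := by
  have hz := abs_nonneg z
  have key : ∀ t ∈ Set.uIcc 0 T,
      HasDerivAt (fun t => Real.log (1 + t * |z|)) (|z| / (1 + t * |z|)) t := by
    intro t ht
    rw [Set.uIcc_of_le hT] at ht
    have h1 : 0 < 1 + t * |z| := by have := ht.1; positivity
    simpa using (((hasDerivAt_id t).mul_const |z|).const_add 1).log h1.ne'
  rw [intervalIntegral.integral_eq_sub_of_hasDerivAt key]
  · simp
  · refine ContinuousOn.intervalIntegrable ?_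
    rw [Set.uIcc_of_le hT]
    refine ContinuousOn.div (by fun_prop) (by fun_prop) fun t ht => ?_
    have := ht.1
    positivity

theorem log_one_add_mul_abs_le {T : ℝ} (hT : 0 ≤ T) (z : ℝ) :
    Real.log (1 + T * |z|) ≤ Real.log (1 + T) + Real.log (1 + |z|) := by
  have hz := abs_nonneg z
  rw [← Real.log_mul (by positivity) (by positivity)]
  refine Real.log_le_log (by positivity) ?_
  nlinarith

theorem log_one_add_abs_nonneg (z : ℝ) : 0 ≤ Real.log (1 + |z|) :=
  Real.log_nonneg (by linarith [abs_nonneg z])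

section

variable {Ω : Type*} [MeasurableSpace Ω] {P : Measure Ω} {Z : Ω → ℝ}

theorem integrable_abs_div_one_add_mul [IsFiniteMeasure P] (hZ : Measurable Z)
    (hlog : Integrable (fun ω => Real.log (1 + |Z ω|)) P) {T : ℝ} (hT : 0 ≤ T) :
    Integrable (fun p : Ω × ℝ => |Z p.1| / (1 + p.2 * |Z p.1|))
      (P.prod (volume.restrict (Set.Ioc 0 T))) := by
  rw [integrable_prod_iff (Measurable.aestronglyMeasurable (by fun_prop))]
  constructor
  · refine .of_forall fun ω => ?_
    simp only
    refine (ContinuousOn.integrableOn_Icc (a := 0) (b := T) ?_).mono_set Set.Ioc_subset_Icc_self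
    refine ContinuousOn.div (by fun_prop) (by fun_prop) fun t ht => ?_
    have := ht.1
    positivity
  · have : Integrable (fun ω => Real.log (1 + T * |Z ω|)) P := by
      refine Integrable.mono' ((integrable_const (Real.log (1 + T))).add hlog)
        (Measurable.aestronglyMeasurable (by fun_prop)) (.of_forall fun ω => ?_)
      have h0 := abs_nonneg (Z ω)
      rw [Real.norm_of_nonneg (Real.log_nonneg (by have := mul_nonneg hT h0; linarith))]
      exact log_one_add_mul_abs_le hT _
    refine this.congr (.of_forall fun ω => ?_)
    simp only
    rw [← integral_abs_div_one_add_mul hT, intervalIntegral.integral_of_le hT]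
    refine setIntegral_congr_fun measurableSet_Ioc fun t ht => ?_
    have := ht.1.le
    rw [Real.norm_of_nonneg (by positivity)]

theorem integrable_mul_sinc [IsFiniteMeasure P] (hZ : Measurable Z)
    (hlog : Integrable (fun ω => Real.log (1 + |Z ω|)) P) {T : ℝ} (hT : 0 ≤ T) :
    Integrable (fun p : Ω × ℝ => Z p.1 * Real.sinc (p.2 * Z p.1))
      (P.prod (volume.restrict (Set.Ioc 0 T))) := by
  refine Integrable.mono' ((integrable_abs_div_one_add_mul hZ hlog hT).const_mul 2)
    (Measurable.aestronglyMeasurable (by fun_prop)) ?_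
  have h : ∀ᵐ p : Ω × ℝ ∂(P.prod (volume.restrict (Set.Ioc 0 T))), p.2 ∈ Set.Ioc 0 T :=
    Measure.quasiMeasurePreserving_snd.ae (ae_restrict_mem measurableSet_Ioc)
  filter_upwards [h] with p hp
  exact abs_mul_sinc_le hp.1.le _

theorem intervalIntegrable_integral_mul_sinc [IsFiniteMeasure P] (hZ : Measurable Z)
    (hlog : Integrable (fun ω => Real.log (1 + |Z ω|)) P) {T : ℝ} (hT : 0 ≤ T) :
    IntervalIntegrable (fun t => ∫ ω, Z ω * Real.sinc (t * Z ω) ∂P) volume 0 T := by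
  rw [intervalIntegrable_iff_integrableOn_Ioc_of_le hT]
  exact (integrable_mul_sinc hZ hlog hT).integral_prod_right

/-- The **Gil-Pelaez inversion formula** at `0`. -/
theorem tendsto_integral_integral_mul_sinc [IsProbabilityMeasure P] (hZ : Measurable Z)
    (hlog : Integrable (fun ω => Real.log (1 + |Z ω|)) P) (h0 : P.real {ω | Z ω = 0} = 0) :
    Tendsto (fun T : ℝ => 1 / 2 - 1 / Real.pi *
        ∫ t in (0 : ℝ)..T, ∫ ω, Z ω * Real.sinc (t * Z ω) ∂P) atTop
      (𝓝 (P.real {ω | Z ω ≤ 0})) := by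
  -- After Fubini the t-integral is the sine integral at TZ, which is bounded and tends to π/2 times
  -- the sign of Z.
  have hsw : ∀ᶠ T : ℝ in atTop, ∫ ω, (∫ x in (0 : ℝ)..(T * Z ω), Real.sinc x) ∂P =
      ∫ t in (0 : ℝ)..T, ∫ ω, Z ω * Real.sinc (t * Z ω) ∂P := by
    filter_upwards [eventually_ge_atTop 0] with T hT
    have := integral_integral_swap (f := fun ω t => Z ω * Real.sinc (t * Z ω))
      (integrable_mul_sinc hZ hlog hT)
    rw [intervalIntegral.integral_of_le hT, ← this]
    refine integral_congr_ae (.of_forall fun ω => ?_)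
    simp only
    rw [← integral_mul_sinc, intervalIntegral.integral_of_le hT]
  obtain ⟨C, hC⟩ := exists_abs_integral_sinc_le
  set A := {ω | Z ω ≤ 0} with hA
  have hAm : MeasurableSet A := measurableSet_le hZ measurable_const
  have hlim : Tendsto (fun T : ℝ => ∫ ω, (∫ x in (0 : ℝ)..(T * Z ω), Real.sinc x) ∂P) atTop
      (𝓝 (∫ ω, (Real.pi / 2 - A.indicator (fun _ => Real.pi) ω) ∂P)) := by
    refine tendsto_integral_filter_of_dominated_convergence (fun _ => C) ?_ ?_
      (integrable_const _) ?_
    · exact .of_forall fun T => (continuous_integral_sinc.measurable.comp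
        (hZ.const_mul T)).aestronglyMeasurable
    · exact .of_forall fun T => .of_forall fun ω => hC _
    · have h0' : ∀ᵐ ω ∂P, Z ω ≠ 0 := by
        rw [ae_iff]
        simpa [Measure.real, ENNReal.toReal_eq_zero_iff] using h0
      filter_upwards [h0'] with ω hω
      rcases hω.lt_or_gt with h | h
      · have : ω ∈ A := h.le
        rw [Set.indicator_of_mem this, show Real.pi / 2 - Real.pi = -(Real.pi / 2) by ring]
        exact tendsto_integral_sinc_atBot.comp (tendsto_id.atTop_mul_const_of_neg h)
      · have : ω ∉ A := fun h' => absurd h (not_lt.2 h')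
        rw [Set.indicator_of_notMem this, sub_zero]
        exact tendsto_integral_sinc_atTop.comp (tendsto_id.atTop_mul_const h)
  have hval : ∫ ω, (Real.pi / 2 - A.indicator (fun _ => Real.pi) ω) ∂P =
      Real.pi / 2 - P.real A * Real.pi := by
    rw [integral_sub (integrable_const _) ((integrable_const _).indicator hAm),
      integral_indicator_const _ hAm]
    simp
  rw [hval] at hlim
  have h1 := ((hlim.congr' hsw).const_mul (1 / Real.pi)).const_sub (1 / 2)
  convert h1 using 2
  field_simp
  ring

end

/-! ### Logarithmic moments and the characteristic function near 0. -/

theorem one_sub_cos_div_nonneg {v : ℝ} (hv : 0 ≤ v) (z : ℝ) : 0 ≤ (1 - Real.cos (v * z)) / v :=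
  div_nonneg (sub_nonneg.2 (Real.cos_le_one _)) hv

theorem integrableOn_one_sub_cos_div (ε z : ℝ) :
    IntegrableOn (fun v => (1 - Real.cos (v * z)) / v) (Set.Ioc 0 ε) := by
  refine Integrable.mono' (g := fun _ => ε * z ^ 2 / 2) (integrable_const _)
    (Measurable.aestronglyMeasurable (by fun_prop)) ?_
  filter_upwards [ae_restrict_mem measurableSet_Ioc] with v hv
  have hv0 := hv.1
  rw [Real.norm_of_nonneg (one_sub_cos_div_nonneg hv0.le z), div_le_iff₀ hv0]
  have h1 := Real.one_sub_sq_div_two_le_cos (x := v * z)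
  have h2 : v * z ^ 2 * v ≤ ε * z ^ 2 * v := by
    gcongr
    exact hv.2
  nlinarith

/-- On [1/z, ε] integrate cos(vz)/v by parts. The extra term 1/(vz) in the comparison function `G`
makes the remainder -(1 - sin(vz))z/(vz)² one-signed, so `G'` lies below the integrand. The constant
2 comes from sin 1 - 1 ≥ -2. -/
theorem log_mul_sub_two_le_integral_one_sub_cos_div {ε z : ℝ} (hε : 0 < ε) (hz : 0 < z)
    (hεz : 1 ≤ ε * z) :
    Real.log (ε * z) - 2 ≤ ∫ v in (0 : ℝ)..ε, (1 - Real.cos (v * z)) / v := by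
  have hle : z⁻¹ ≤ ε := by rwa [inv_le_iff_one_le_mul₀ hz]
  have hz' : 0 < z⁻¹ := inv_pos.2 hz
  have hint : IntervalIntegrable (fun v => (1 - Real.cos (v * z)) / v) volume 0 ε :=
    (intervalIntegrable_iff_integrableOn_Ioc_of_le hε.le).2 (integrableOn_one_sub_cos_div ε z)
  set G : ℝ → ℝ := fun v => Real.log v - Real.sin (v * z) * (v * z)⁻¹ + (v * z)⁻¹
  set G' : ℝ → ℝ := fun v =>
    v⁻¹ - (Real.cos (v * z) * z * (v * z)⁻¹ + Real.sin (v * z) * (-z / (v * z) ^ 2)) +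
      (-z / (v * z) ^ 2)
  have hG : ∀ v ∈ Set.uIcc z⁻¹ ε, HasDerivAt G (G' v) v := by
    intro v hv
    rw [Set.uIcc_of_le hle] at hv
    have hv0 : 0 < v := hz'.trans_le hv.1
    have h1 : HasDerivAt (fun v => v * z) z v := by simpa using (hasDerivAt_id v).mul_const z
    have h2 : HasDerivAt (fun v => (v * z)⁻¹) (-z / (v * z) ^ 2) v := h1.fun_inv (by positivity)
    exact ((Real.hasDerivAt_log hv0.ne').sub (h1.sin.mul h2)).add h2
  have hG'c : ContinuousOn G' (Set.uIcc z⁻¹ ε) := by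
    rw [Set.uIcc_of_le hle]
    have h0 : ∀ v ∈ Set.Icc z⁻¹ ε, v ≠ 0 := fun v hv => (hz'.trans_le hv.1).ne'
    have h1 : ∀ v ∈ Set.Icc z⁻¹ ε, v * z ≠ 0 := fun v hv => mul_ne_zero (h0 v hv) hz.ne'
    have h2 : ∀ v ∈ Set.Icc z⁻¹ ε, (v * z) ^ 2 ≠ 0 := fun v hv => pow_ne_zero 2 (h1 v hv)
    fun_prop (disch := assumption)
  have hFTC := intervalIntegral.integral_eq_sub_of_hasDerivAt hG hG'c.intervalIntegrable
  have hmono : ∫ v in z⁻¹..ε, G' v ≤ ∫ v in z⁻¹..ε, (1 - Real.cos (v * z)) / v := by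
    refine intervalIntegral.integral_mono_on hle hG'c.intervalIntegrable
      (hint.mono_set ?_) fun v hv => ?_
    · rw [Set.uIcc_of_le hle, Set.uIcc_of_le hε.le]
      exact Set.Icc_subset_Icc_left hz'.le
    · have hv0 : 0 < v := hz'.trans_le hv.1
      have h3 : G' v = (1 - Real.cos (v * z)) / v -
          (1 - Real.sin (v * z)) * (z / (v * z) ^ 2) := by
        simp only [G']
        field_simp
        ring
      have h4 : 0 ≤ (1 - Real.sin (v * z)) * (z / (v * z) ^ 2) :=
        mul_nonneg (sub_nonneg.2 (Real.sin_le_one _)) (by positivity)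
      linarith
  have hsub : ∫ v in z⁻¹..ε, (1 - Real.cos (v * z)) / v ≤
      ∫ v in (0 : ℝ)..ε, (1 - Real.cos (v * z)) / v := by
    refine intervalIntegral.integral_mono_interval hz'.le hle le_rfl ?_ hint
    filter_upwards [ae_restrict_mem measurableSet_Ioc] with v hv
    exact one_sub_cos_div_nonneg hv.1.le z
  have hval : Real.log (ε * z) - 2 ≤ G ε - G z⁻¹ := by
    simp only [G]
    rw [inv_mul_cancel₀ hz.ne', Real.log_inv, Real.log_mul hε.ne' hz.ne']
    have h5 : 0 ≤ (1 - Real.sin (ε * z)) * (ε * z)⁻¹ :=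
      mul_nonneg (sub_nonneg.2 (Real.sin_le_one _)) (by positivity)
    have h6 := Real.neg_one_le_sin 1
    simp only [inv_one, mul_one]
    linarith
  linarith

theorem log_one_add_abs_le_integral_one_sub_cos_div {ε : ℝ} (hε : 0 < ε) (z : ℝ) :
    Real.log (1 + |z|) ≤
      (∫ v in (0 : ℝ)..ε, (1 - Real.cos (v * z)) / v) + (2 + Real.log (1 + ε⁻¹)) := by
  have hε' := inv_pos.2 hε
  have hz := abs_nonneg z
  have hcos : ∀ v, Real.cos (v * z) = Real.cos (v * |z|) := fun v => by
    rcases abs_choice z with h | h <;> simp [h]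
  have hnonneg : 0 ≤ ∫ v in (0 : ℝ)..ε, (1 - Real.cos (v * z)) / v :=
    intervalIntegral.integral_nonneg hε.le fun v hv => one_sub_cos_div_nonneg hv.1 z
  rcases lt_or_ge (ε * |z|) 1 with h | h
  · have h1 : |z| ≤ ε⁻¹ := by
      rw [← one_div, le_div_iff₀ hε]
      linarith
    have := Real.log_le_log (by positivity) (show 1 + |z| ≤ 1 + ε⁻¹ by linarith)
    linarith
  · have hz0 : 0 < |z| := by
      rcases hz.eq_or_lt with h0 | h0
      · rw [← h0, mul_zero] at h
        linarith
      · exact h0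
    have h1 := log_mul_sub_two_le_integral_one_sub_cos_div hε hz0 h
    simp_rw [← hcos] at h1
    -- Since ε|z| ≥ 1, 1 + |z| ≤ ε|z| + |z| = ε|z|(1 + 1/ε).
    have h2 : Real.log (1 + |z|) ≤ Real.log (ε * |z|) + Real.log (1 + ε⁻¹) := by
      rw [← Real.log_mul (by positivity) (by positivity)]
      refine Real.log_le_log (by positivity) ?_
      have : ε * |z| * (1 + ε⁻¹) = ε * |z| + |z| := by field_simp
      linarith
    linarith

theorem integrable_log_one_add_abs_of_cos {Ω : Type*} [MeasurableSpace Ω] {P : Measure Ω}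
    [IsProbabilityMeasure P] {Z : Ω → ℝ} (hZ : Measurable Z) {ε : ℝ} (hε : 0 < ε)
    (hint : IntegrableOn (fun v => (1 - ∫ ω, Real.cos (v * Z ω) ∂P) / v) (Set.Ioc 0 ε)) :
    Integrable (fun ω => Real.log (1 + |Z ω|)) P := by
  have hcos : ∀ v : ℝ, Integrable (fun ω => Real.cos (v * Z ω)) P := fun v =>
    Integrable.of_bound (Measurable.aestronglyMeasurable (by fun_prop)) 1
      (.of_forall fun ω => Real.abs_cos_le_one _)
  have hprod : Integrable (fun p : Ω × ℝ => (1 - Real.cos (p.2 * Z p.1)) / p.2)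
      (P.prod (volume.restrict (Set.Ioc 0 ε))) := by
    rw [integrable_prod_iff' (Measurable.aestronglyMeasurable (by fun_prop))]
    constructor
    · exact .of_forall fun v => ((integrable_const _).sub (hcos v)).div_const v
    · refine hint.congr ?_
      filter_upwards [ae_restrict_mem measurableSet_Ioc] with v hv
      rw [← integral_congr_ae (.of_forall fun ω =>
        (Real.norm_of_nonneg (one_sub_cos_div_nonneg hv.1.le (Z ω))).symm)]
      rw [integral_div, integral_sub (integrable_const _) (hcos v)]
      simp
  have h1 := hprod.integral_prod_left
  refine Integrable.mono' (h1.add (integrable_const (2 + Real.log (1 + ε⁻¹))))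
    (Measurable.aestronglyMeasurable (by fun_prop)) (.of_forall fun ω => ?_)
  rw [Real.norm_of_nonneg (log_one_add_abs_nonneg _)]
  simp only [Pi.add_apply]
  rw [← intervalIntegral.integral_of_le hε.le]
  exact log_one_add_abs_le_integral_one_sub_cos_div hε _

theorem log_one_add_abs_le_add (x y : ℝ) :
    Real.log (1 + |x|) ≤ Real.log (1 + |x - y|) + Real.log (1 + |y|) := by
  have h1 := abs_nonneg (x - y)
  have h2 := abs_nonneg y
  have h3 : |x| ≤ |x - y| + |y| := by simpa using abs_add_le (x - y) y
  rw [← Real.log_mul (by positivity) (by positivity)]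
  refine Real.log_le_log (by positivity) ?_
  nlinarith [mul_nonneg h1 h2]

section

variable {μ : Measure ℝ} [IsProbabilityMeasure μ]

theorem integrable_exp_mul_I (v : ℝ) :
    Integrable (fun x : ℝ => Complex.exp (v * x * Complex.I)) μ :=
  Integrable.of_bound (Measurable.aestronglyMeasurable (by fun_prop)) 1
    (.of_forall fun x => by
      rw [← Complex.ofReal_mul, Complex.norm_exp_ofReal_mul_I])

theorem integral_prod_cos_sub (v : ℝ) :
    ∫ p : ℝ × ℝ, Real.cos (v * (p.1 - p.2)) ∂(μ.prod μ) = ‖charFun μ v‖ ^ 2 := by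
  have hexp : ∫ p : ℝ × ℝ, Complex.exp ((v * (p.1 - p.2) : ℝ) * Complex.I) ∂(μ.prod μ) =
      charFun μ v * charFun μ (-v) := by
    rw [charFun_apply_real, charFun_apply_real, ← integral_prod_mul]
    refine integral_congr_ae (.of_forall fun p => ?_)
    simp only
    rw [← Complex.exp_add]
    congr 1
    push_cast
    ring
  rw [charFun_neg, Complex.mul_conj, Complex.normSq_eq_norm_sq] at hexp
  have hint : Integrable (fun p : ℝ × ℝ => Complex.exp ((v * (p.1 - p.2) : ℝ) * Complex.I))
      (μ.prod μ) :=
    Integrable.of_bound (Measurable.aestronglyMeasurable (by fun_prop)) 1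
      (.of_forall fun x => by rw [Complex.norm_exp_ofReal_mul_I])
  have hre := congrArg Complex.re hexp
  have h2 := integral_re hint
  simp only [RCLike.re_to_complex] at h2
  rw [← h2, Complex.ofReal_re] at hre
  rw [← hre]
  refine integral_congr_ae (.of_forall fun p => ?_)
  exact (Complex.exp_ofReal_mul_I_re _).symm

/-- Symmetrize: |charFun|² is the cosine transform of x - y under μ ⊗ μ, which gives a log moment of
x - y. By Fubini some fixed y works, and a fixed shift preserves log moments. -/
theorem integrable_log_one_add_abs_of_charFun {ε : ℝ} (hε : 0 < ε)
    (hint : IntegrableOn (fun v => (1 - ‖charFun μ v‖ ^ 2) / v) (Set.Ioc 0 ε)) :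
    Integrable (fun x => Real.log (1 + |x|)) μ := by
  have h1 : Integrable (fun p : ℝ × ℝ => Real.log (1 + |p.1 - p.2|)) (μ.prod μ) := by
    refine integrable_log_one_add_abs_of_cos (by fun_prop) hε ?_
    simpa only [integral_prod_cos_sub] using hint
  obtain ⟨y, hy⟩ := h1.prod_left_ae.exists
  refine Integrable.mono' (hy.add (integrable_const (Real.log (1 + |y|))))
    (Measurable.aestronglyMeasurable (by fun_prop)) (.of_forall fun x => ?_)
  rw [Real.norm_of_nonneg (log_one_add_abs_nonneg _)]
  exact log_one_add_abs_le_add x y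

/-- The bounds v|x| and 2 on the numerator combine with constant 1 + 2 into the kernel whose
v-integral is a logarithm. -/
theorem norm_exp_mul_I_sub_one_div_le {v : ℝ} (hv : 0 < v) (x : ℝ) :
    ‖(Complex.exp (v * x * Complex.I) - 1) / v‖ ≤ 3 * (|x| / (1 + v * |x|)) := by
  have hx := abs_nonneg x
  have h1 : ‖Complex.exp (v * x * Complex.I) - 1‖ ≤ v * |x| := by
    have := Real.norm_exp_I_mul_ofReal_sub_one_le (x := v * x)
    rw [Real.norm_eq_abs, abs_mul, abs_of_pos hv] at this
    convert this using 3
    push_cast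
    ring_nf
  have h2 : ‖Complex.exp (v * x * Complex.I) - 1‖ ≤ 2 := by
    refine (norm_sub_le _ _).trans ?_
    rw [← Complex.ofReal_mul, Complex.norm_exp_ofReal_mul_I]
    norm_num
  have h3 : 0 < 1 + v * |x| := by positivity
  rw [norm_div, Complex.norm_real, Real.norm_of_nonneg hv.le, div_le_iff₀ hv,
    show 3 * (|x| / (1 + v * |x|)) * v = 3 * |x| * v / (1 + v * |x|) by ring, le_div_iff₀ h3]
  nlinarith [mul_nonneg hv.le hx]

theorem integrableOn_charFun_sub_one_div (hlog : Integrable (fun x => Real.log (1 + |x|)) μ)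
    {T : ℝ} (hT : 0 ≤ T) :
    IntegrableOn (fun v : ℝ => (charFun μ v - 1) / v) (Set.Ioc 0 T) := by
  have h1 : Integrable (fun p : ℝ × ℝ => (Complex.exp (p.2 * p.1 * Complex.I) - 1) / (p.2 : ℂ))
      (μ.prod (volume.restrict (Set.Ioc 0 T))) := by
    refine Integrable.mono' ((integrable_abs_div_one_add_mul measurable_id hlog hT).const_mul 3)
      (Measurable.aestronglyMeasurable (by fun_prop)) ?_
    have h : ∀ᵐ p : ℝ × ℝ ∂(μ.prod (volume.restrict (Set.Ioc 0 T))), p.2 ∈ Set.Ioc 0 T :=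
      Measure.quasiMeasurePreserving_snd.ae (ae_restrict_mem measurableSet_Ioc)
    filter_upwards [h] with p hp
    exact norm_exp_mul_I_sub_one_div_le hp.1 _
  refine h1.integral_prod_right.congr (.of_forall fun v => ?_)
  simp only
  rw [integral_div, integral_sub (integrable_exp_mul_I v) (integrable_const _),
    charFun_apply_real]
  simp

theorem intervalIntegrable_exponent_div {η : ℝ → ℂ} (hη : Continuous η) (h0 : η 0 = 0)
    (hexp : ∀ u, charFun μ u = Complex.exp (η u))
    (hlog : Integrable (fun x => Real.log (1 + |x|)) μ) (T : ℝ) :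
    IntervalIntegrable (fun v : ℝ => η v / v) volume 0 T := by
  obtain ⟨ε, hε, hsmall⟩ : ∃ ε > 0, ∀ v : ℝ, |v| ≤ ε → ‖η v‖ ≤ 1 / 2 := by
    have h1 : ∀ᶠ v in 𝓝 (0 : ℝ), ‖η v‖ < 1 / 2 := by
      have : Tendsto (fun v => ‖η v‖) (𝓝 0) (𝓝 0) := by simpa [h0] using (hη.norm.tendsto 0)
      exact this.eventually_lt_const (by norm_num)
    obtain ⟨δ, hδ, h⟩ := Metric.eventually_nhds_iff.1 h1
    refine ⟨δ / 2, by positivity, fun v hv => (h ?_).le⟩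
    rw [Real.dist_0_eq_abs]
    linarith
  -- For |η| ≤ 1/2, |e^η - 1 - η| ≤ |η|² ≤ |η|/2, so |η| ≤ 2|e^η - 1|.
  have hbound : ∀ v : ℝ, |v| ≤ ε → ‖η v‖ ≤ 2 * ‖charFun μ v - 1‖ := by
    intro v hv
    have h1 := hsmall v hv
    have h2 := Complex.norm_exp_sub_one_sub_id_le (x := η v) (by linarith)
    rw [hexp]
    have h3 : ‖η v‖ ≤ ‖Complex.exp (η v) - 1‖ + ‖Complex.exp (η v) - 1 - η v‖ := by
      simpa using norm_sub_le (Complex.exp (η v) - 1) (Complex.exp (η v) - 1 - η v)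
    nlinarith [norm_nonneg (η v)]
  have hnorm : ∀ v : ℝ, ‖charFun μ (-v) - 1‖ = ‖charFun μ v - 1‖ := by
    intro v
    rw [charFun_neg, ← Complex.norm_conj, map_sub, Complex.conj_conj, map_one]
  -- The sign σ = ±1 reduces negative T to positive T; conjugation symmetry of the characteristic
  -- function makes the bound independent of σ.
  have hmain : ∀ σ : ℝ, |σ| = 1 → ∀ T : ℝ, 0 ≤ T →
      IntervalIntegrable (fun v : ℝ => η (σ * v) / v) volume 0 T := by
    intro σ hσ T hT
    have hc : Continuous fun v : ℝ => η (σ * v) := by fun_prop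
    have h1 : IntervalIntegrable (fun v : ℝ => η (σ * v) / v) volume 0 ε := by
      rw [intervalIntegrable_iff_integrableOn_Ioc_of_le hε.le]
      refine Integrable.mono'
        ((integrableOn_charFun_sub_one_div hlog hε.le).norm.const_mul 2)
        (hc.measurable.div (by fun_prop)).aestronglyMeasurable ?_
      filter_upwards [ae_restrict_mem measurableSet_Ioc] with v hv
      rw [norm_div, norm_div, ← mul_div_assoc]
      gcongr
      refine (hbound _ ?_).trans_eq ?_
      · rw [abs_mul, hσ, one_mul, abs_of_pos hv.1]
        exact hv.2
      · rcases eq_or_eq_neg_of_abs_eq hσ with rfl | rfl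
        · rw [one_mul]
        · rw [neg_one_mul, hnorm]
    rcases le_total T ε with hTε | hTε
    · refine h1.mono_set ?_
      rw [Set.uIcc_of_le hT, Set.uIcc_of_le hε.le]
      exact Set.Icc_subset_Icc_right hTε
    · refine h1.trans (ContinuousOn.intervalIntegrable ?_)
      rw [Set.uIcc_of_le hTε]
      refine hc.continuousOn.div (by fun_prop) fun v hv => ?_
      exact_mod_cast (hε.trans_le hv.1).ne'
  rcases le_total 0 T with hT | hT
  · simpa using hmain 1 (by simp) T hT
  · rw [IntervalIntegrable.iff_comp_neg]
    have := (hmain (-1) (by simp) (-T) (by linarith)).neg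
    rw [neg_zero]
    refine this.congr fun v _ => ?_
    simp [div_neg]

end

/-! ### The characteristic exponent of a Lévy process. -/

theorem norm_sub_le_of_mul {z : ℝ≥0 → ℂ} (hadd : ∀ s t, z (s + t) = z s * z t)
    (hle : ∀ t, ‖z t‖ ≤ 1) (s t : ℝ≥0) : ‖z (s + t) - z s‖ ≤ ‖z t - 1‖ := by
  rw [hadd, ← mul_sub_one, norm_mul]
  exact mul_le_of_le_one_left (norm_nonneg _) (hle s)

theorem continuous_of_mul_of_norm_le_one {z : ℝ≥0 → ℂ} (hadd : ∀ s t, z (s + t) = z s * z t)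
    (hle : ∀ t, ‖z t‖ ≤ 1) (hlim : Tendsto z (𝓝 0) (𝓝 1)) : Continuous z := by
  rw [Metric.continuous_iff]
  intro t ε hε
  obtain ⟨δ, hδ, h⟩ := Metric.tendsto_nhds_nhds.1 hlim ε hε
  have key : ∀ a b : ℝ≥0, a ≤ b → dist b a < δ → dist (z b) (z a) < ε := by
    intro a b hab hd
    obtain ⟨c, rfl⟩ := exists_add_of_le hab
    have hc : dist c 0 < δ := by
      rw [NNReal.dist_eq] at hd ⊢
      simpa using hd
    rw [dist_eq_norm]
    refine (norm_sub_le_of_mul hadd hle a c).trans_lt ?_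
    rw [← dist_eq_norm]
    exact h hc
  refine ⟨δ, hδ, fun s hs => ?_⟩
  rcases le_total t s with h' | h'
  · exact key t s h' hs
  · rw [dist_comm]
    exact key s t h' (by rwa [dist_comm])

/-- A multiplicative semigroup in the complex unit disc which is continuous at
`0` is exponential. -/
theorem exists_eq_exp_of_mul {z : ℝ≥0 → ℂ} (hadd : ∀ s t, z (s + t) = z s * z t)
    (h0 : z 0 = 1) (hle : ∀ t, ‖z t‖ ≤ 1) (hlim : Tendsto z (𝓝 0) (𝓝 1)) :
    ∃ a : ℂ, (∀ t, z t = Complex.exp (t * a)) ∧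
      ∃ h : ℝ, 0 < h ∧ (∫ s in (0 : ℝ)..h, z s.toNNReal) ≠ 0 := by
  have hc := continuous_of_mul_of_norm_le_one hadd hle hlim
  set Z : ℝ → ℂ := fun t => z t.toNNReal with hZ
  have hZc : Continuous Z := hc.comp continuous_real_toNNReal
  have hZi : ∀ a b, IntervalIntegrable Z volume a b := fun a b => hZc.intervalIntegrable _ _
  set J : ℝ → ℂ := fun t => ∫ s in (0 : ℝ)..t, Z s with hJ
  have hJd : ∀ t, HasDerivAt J (Z t) t := fun t =>
    intervalIntegral.integral_hasDerivAt_right (hZi _ _)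
      (hZc.stronglyMeasurableAtFilter _ _) hZc.continuousAt
  obtain ⟨h, hh, hne⟩ : ∃ h : ℝ, 0 < h ∧ J h ≠ 0 := by
    have h1 := (hJd 0).eventually_ne (c := 0) (by simp [hZ, h0])
    obtain ⟨h, hh1, hh2⟩ := ((h1.filter_mono (nhdsWithin_mono 0
      (fun x (hx : x ∈ Set.Ioi (0 : ℝ)) => ne_of_gt hx))).and self_mem_nhdsWithin).exists
    exact ⟨h, hh2, hh1⟩
  -- The semigroup law makes Z a quotient of increments of its own primitive, so continuity alone
  -- forces differentiability.
  have hW : ∀ t : ℝ, 0 ≤ t → J (t + h) - J t = Z t * J h := by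
    intro t ht
    have h1 : J (t + h) - J t = ∫ s in t..(t + h), Z s :=
      intervalIntegral.integral_interval_sub_left (hZi _ _) (hZi _ _)
    rw [h1, hJ]
    simp only
    rw [← intervalIntegral.integral_const_mul]
    have h2 := intervalIntegral.integral_comp_add_left (a := 0) (b := h) Z t
    rw [add_zero] at h2
    rw [← h2]
    refine intervalIntegral.integral_congr fun s hs => ?_
    rw [Set.uIcc_of_le hh.le] at hs
    simp only [hZ]
    rw [Real.toNNReal_add ht hs.1, hadd]
  set a : ℂ := (Z h - 1) / J h with ha
  have hderiv : ∀ t : ℝ, 0 ≤ t → HasDerivWithinAt Z (a * Z t) (Set.Ici t) t := by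
    intro t ht
    have h1 : HasDerivAt (fun t => (J (t + h) - J t) / J h) ((Z (t + h) - Z t) / J h) t :=
      (((hJd (t + h)).comp_add_const t h).sub (hJd t)).div_const _
    have h2 : (Z (t + h) - Z t) / J h = a * Z t := by
      simp only [ha, hZ]
      rw [Real.toNNReal_add ht hh.le, hadd]
      ring
    rw [h2] at h1
    refine h1.hasDerivWithinAt.congr (fun s hs => ?_) ?_
    · rw [hW s (ht.trans hs), mul_div_cancel_right₀ _ hne]
    · rw [hW t ht, mul_div_cancel_right₀ _ hne]
  refine ⟨a, fun t => ?_, h, hh, hne⟩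
  have hexp : ∀ s : ℝ, HasDerivAt (fun s : ℝ => Complex.exp (-(s * a)))
      (Complex.exp (-(s * a)) * -(1 * a)) s := fun s =>
    (((hasDerivAt_id s).ofReal_comp.mul_const a).neg).cexp
  -- Z solves Z' = aZ from the right, so Z(s)e^{-sa} is constant.
  have hconst := constant_of_has_deriv_right_zero (a := 0) (b := (t : ℝ))
    (f := fun s : ℝ => Z s * Complex.exp (-(s * a))) (by fun_prop)
    (fun s hs => by
      refine ((hderiv s hs.1).mul (hexp s).hasDerivWithinAt).congr_deriv ?_
      ring) t ⟨t.2, le_rfl⟩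
  simp only [hZ, Real.toNNReal_coe, Real.toNNReal_zero, h0, Complex.ofReal_zero, zero_mul,
    neg_zero, Complex.exp_zero, mul_one] at hconst
  rw [Complex.exp_neg] at hconst
  have := mul_inv_eq_one₀ (Complex.exp_ne_zero ((t : ℝ) * a)) |>.1 hconst
  simpa using this

/-- No branch of the logarithm is chosen: η(u) = (z_h(u) - 1) / ∫_0^h z_s(u) ds whenever the
denominator is nonzero. An h that works at one point works nearby, so η inherits continuity from
this quotient. -/
theorem exists_continuous_exponent {z : ℝ≥0 → ℝ → ℂ}
    (hadd : ∀ s t u, z (s + t) u = z s u * z t u) (h0 : ∀ u, z 0 u = 1) (h0' : ∀ t, z t 0 = 1)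
    (hle : ∀ t u, ‖z t u‖ ≤ 1) (hc : ∀ t, Continuous (z t))
    (hlim : ∀ u, Tendsto (fun t => z t u) (𝓝 0) (𝓝 1)) :
    ∃ η : ℝ → ℂ, Continuous η ∧ η 0 = 0 ∧ ∀ (t : ℝ≥0) u, z t u = Complex.exp (t * η u) := by
  choose η hη using fun u =>
    exists_eq_exp_of_mul (fun s t => hadd s t u) (h0 u) (fun t => hle t u) (hlim u)
  have hZc : ∀ u, Continuous fun s : ℝ => z s.toNNReal u := fun u =>
    (continuous_of_mul_of_norm_le_one (fun s t => hadd s t u) (fun t => hle t u)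
      (hlim u)).comp continuous_real_toNNReal
  have hform : ∀ (h : ℝ), 0 ≤ h → ∀ u,
      (∫ s in (0 : ℝ)..h, z s.toNNReal u) * η u = z h.toNNReal u - 1 := by
    intro h hh u
    rw [← intervalIntegral.integral_mul_const]
    have hd : ∀ s : ℝ, HasDerivAt (fun s : ℝ => Complex.exp (s * η u))
        (Complex.exp (s * η u) * (1 * η u)) s := fun s =>
      ((hasDerivAt_id s).ofReal_comp.mul_const (η u)).cexp
    have := intervalIntegral.integral_eq_sub_of_hasDerivAt (a := 0) (b := h) (fun s _ => hd s)
      (Continuous.intervalIntegrable (by fun_prop) _ _)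
    rw [(hη u).1 h.toNNReal, Real.coe_toNNReal _ hh]
    simp only [Complex.ofReal_zero, zero_mul, Complex.exp_zero, one_mul] at this
    rw [← this]
    refine intervalIntegral.integral_congr fun s hs => ?_
    rw [Set.uIcc_of_le hh] at hs
    rw [(hη u).1, Real.coe_toNNReal _ hs.1]
  refine ⟨η, ?_, ?_, fun t u => (hη u).1 t⟩
  · rw [continuous_iff_continuousAt]
    intro u
    obtain ⟨h, hh, hne⟩ := (hη u).2
    have hI : Continuous fun u => ∫ s in (0 : ℝ)..h, z s.toNNReal u := by
      refine intervalIntegral.continuous_of_dominated_interval (bound := fun _ => 1)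
        (fun u => (hZc u).aestronglyMeasurable) (fun u => .of_forall fun s _ => hle _ _)
        intervalIntegrable_const (.of_forall fun s _ => hc _)
    have h1 : ContinuousAt (fun u => (z h.toNNReal u - 1) / ∫ s in (0 : ℝ)..h, z s.toNNReal u) u :=
      ((hc _).sub continuous_const).continuousAt.div hI.continuousAt hne
    refine h1.congr ?_
    filter_upwards [hI.continuousAt.eventually_ne hne] with v hv
    rw [← hform h hh.le v, mul_div_cancel_left₀ _ hv]
  · obtain ⟨h, hh, hne⟩ := (hη 0).2
    have := hform h hh.le 0
    rw [h0', sub_self] at this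
    exact (mul_eq_zero.1 this).resolve_left hne

namespace IsLevyProcess

variable {Ω : Type*} [MeasurableSpace Ω] {Y : ℝ≥0 → Ω → ℝ} {P : Measure Ω}

theorem charFun_map_sub (hY : IsLevyProcess Y P) (s t : ℝ≥0) :
    charFun (P.map fun ω => Y (s + t) ω - Y s ω) = charFun (P.map (Y t)) := by
  rw [(hY.stationary_increments s t).map_eq]
  congr 1
  refine Measure.map_congr ?_
  filter_upwards [hY.zero] with ω hω
  rw [hω, sub_zero]

variable [IsProbabilityMeasure P]

theorem charFun_map_add (hY : IsLevyProcess Y P) (s t : ℝ≥0) (u : ℝ) :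
    charFun (P.map (Y (s + t))) u = charFun (P.map (Y s)) u * charFun (P.map (Y t)) u := by
  have hind := hY.indep_increments.indepFun_eval_sub (zero_le (a := s)) (le_add_of_nonneg_right (zero_le (a := t)))
    hY.zero
  have h1 := hind.charFun_map_add_eq_mul (hY.measurable s).aemeasurable
    ((hY.measurable (s + t)).sub (hY.measurable s)).aemeasurable
  rw [add_sub_cancel] at h1
  rw [h1, Pi.mul_apply, ← hY.charFun_map_sub s t]
  rfl

theorem tendsto_charFun_map_zero (hY : IsLevyProcess Y P) (u : ℝ) :
    Tendsto (fun t => charFun (P.map (Y t)) u) (𝓝 0) (𝓝 1) := by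
  have h1 : ∀ t, charFun (P.map (Y t)) u = ∫ ω, Complex.exp (u * Y t ω * Complex.I) ∂P := by
    intro t
    rw [charFun_apply_real, integral_map (hY.measurable t).aemeasurable
      (Measurable.aestronglyMeasurable (by fun_prop))]
  have h2 : (1 : ℂ) = ∫ _, 1 ∂P := by simp
  simp_rw [h1]
  rw [h2]
  refine tendsto_integral_filter_of_dominated_convergence (fun _ => 1) ?_ ?_
    (integrable_const _) ?_
  · refine .of_forall fun t => Measurable.aestronglyMeasurable ?_
    have := hY.measurable t
    fun_prop
  · refine .of_forall fun t => .of_forall fun ω => ?_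
    rw [← Complex.ofReal_mul, Complex.norm_exp_ofReal_mul_I]
  · filter_upwards [hY.zero, hY.cadlag] with ω hω0 hω
    have h3 := (hω 0).1
    -- At 0 right-continuity is full continuity, since the time set is ℝ≥0.
    rw [show Set.Ici (0 : ℝ≥0) = Set.univ from Set.eq_univ_of_forall fun _ => Set.mem_Ici.2 zero_le,
      continuousWithinAt_univ] at h3
    have h4 : ContinuousAt (fun t => Complex.exp (u * Y t ω * Complex.I)) 0 := by fun_prop
    simpa [ContinuousAt, hω0] using h4

theorem exists_exponent (hY : IsLevyProcess Y P) :
    ∃ η : ℝ → ℂ, Continuous η ∧ η 0 = 0 ∧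
      ∀ (t : ℝ≥0) u, charFun (P.map (Y t)) u = Complex.exp (t * η u) := by
  have hprob : ∀ t, IsProbabilityMeasure (P.map (Y t)) := fun t =>
    Measure.isProbabilityMeasure_map (hY.measurable t).aemeasurable
  refine exists_continuous_exponent hY.charFun_map_add (fun u => ?_) (fun t => by simp)
    (fun t u => norm_charFun_le_one u) (fun t => continuous_charFun) hY.tendsto_charFun_map_zero
  have h1 : P.map (Y 0) = Measure.dirac 0 := by
    rw [Measure.map_congr (g := fun _ => 0) hY.zero, Measure.map_const]
    simp
  rw [h1, charFun_dirac]
  simp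

end IsLevyProcess

/-! ### Riemann–Stieltjes sums along càdlàg paths. -/

/-- Near each point the left limit bounds the path on the left and right-continuity bounds it on the
right; compactness globalizes. -/
theorem exists_bound_of_cadlag {y : ℝ≥0 → ℝ}
    (hy : ∀ t : ℝ≥0, ContinuousWithinAt y (Set.Ici t) t ∧ ∃ l : ℝ, Tendsto y (𝓝[<] t) (𝓝 l))
    (T : ℝ≥0) : ∃ C, ∀ s ≤ T, ‖y s‖ ≤ C := by
  have h : ∃ C, ∀ s ∈ Set.Icc 0 T, ‖y s‖ ≤ C := by
    refine (isCompact_Icc (a := (0 : ℝ≥0)) (b := T)).induction_on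
      (p := fun A => ∃ C, ∀ s ∈ A, ‖y s‖ ≤ C) ⟨0, by simp⟩
      (fun A B hAB ⟨C, hC⟩ => ⟨C, fun s hs => hC s (hAB hs)⟩)
      (fun A B ⟨C, hC⟩ ⟨D, hD⟩ => ⟨max C D, ?_⟩) fun t _ => ?_
    · rintro s (hs | hs)
      · exact (hC s hs).trans (le_max_left _ _)
      · exact (hD s hs).trans (le_max_right _ _)
    · obtain ⟨hr, l, hl⟩ := hy t
      have h1 := hl.norm.eventually_le_const (lt_add_one ‖l‖)
      have h2 := hr.norm.eventually_le_const (lt_add_one ‖y t‖)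
      have h3 : ∀ᶠ s in 𝓝 t, ‖y s‖ ≤ max (‖l‖ + 1) (‖y t‖ + 1) := by
        rw [← nhdsLT_sup_nhdsGE t, eventually_sup]
        exact ⟨h1.mono fun s hs => hs.trans (le_max_left _ _),
          h2.mono fun s hs => hs.trans (le_max_right _ _)⟩
      exact ⟨_, mem_nhdsWithin_of_mem_nhds h3, _, fun s hs => hs⟩
  obtain ⟨C, hC⟩ := h
  exact ⟨C, fun s hs => hC s ⟨zero_le, hs⟩⟩

theorem ceil_mul_div_mul_div_eq {T s : ℝ} (hT : 0 < T) {n : ℕ} (hn : 0 < n) {k : ℕ}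
    (hs : s ∈ Set.Ioc (k * T / n : ℝ) ((k + 1 : ℕ) * T / n)) :
    ⌈s * n / T⌉₊ = k + 1 := by
  have hn' : (0 : ℝ) < n := by exact_mod_cast hn
  rw [Nat.ceil_eq_iff (by simp)]
  obtain ⟨h1, h2⟩ := hs
  rw [div_lt_iff₀ hn'] at h1
  rw [le_div_iff₀ hn'] at h2
  rw [lt_div_iff₀ hT, div_le_iff₀ hT]
  simpa using ⟨h1, by simpa using h2⟩

/-- Convergence of Riemann–Stieltjes sums of a bounded right-continuous function. -/
theorem tendsto_sum_mul_integral {𝕜 : Type*} [RCLike 𝕜] {f g : ℝ → 𝕜} {T : ℝ} (hT : 0 < T)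
    (hg : Continuous g) {C : ℝ} (hC : ∀ s ∈ Set.Icc 0 T, ‖f s‖ ≤ C)
    (hf : ∀ s ∈ Set.Icc 0 T, ContinuousWithinAt f (Set.Ici s) s) :
    Tendsto (fun n : ℕ => ∑ k ∈ Finset.range n, f ((k + 1 : ℕ) * T / n) *
      ∫ s in (k * T / n : ℝ)..((k + 1 : ℕ) * T / n), g s) atTop
      (𝓝 (∫ s in (0 : ℝ)..T, f s * g s)) := by
  -- The right endpoint of the mesh cell containing s. Since it is never below s and tends to s,
  -- right-continuity of f suffices.
  set c : ℕ → ℝ → ℝ := fun n s => (⌈s * n / T⌉₊ : ℝ) * T / n with hc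
  have hsum : ∀ᶠ n : ℕ in atTop, ∫ s in (0 : ℝ)..T, f (c n s) * g s =
      ∑ k ∈ Finset.range n, f ((k + 1 : ℕ) * T / n) *
        ∫ s in (k * T / n : ℝ)..((k + 1 : ℕ) * T / n), g s := by
    filter_upwards [eventually_gt_atTop 0] with n hn
    have hn' : (0 : ℝ) < n := by exact_mod_cast hn
    have hle : ∀ k : ℕ, (k * T / n : ℝ) ≤ (k + 1 : ℕ) * T / n := fun k => by
      gcongr
      exact k.le_succ
    have heq : ∀ k : ℕ, Set.EqOn (fun s => f ((k + 1 : ℕ) * T / n) * g s)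
        (fun s => f (c n s) * g s) (Set.Ioc (k * T / n : ℝ) ((k + 1 : ℕ) * T / n)) := by
      intro k s hs
      simp only [hc]
      rw [ceil_mul_div_mul_div_eq hT hn hs]
    have hint : ∀ k < n, IntervalIntegrable (fun s => f (c n s) * g s) volume
        (k * T / n) ((k + 1 : ℕ) * T / n) := by
      intro k _
      have h1 : IntervalIntegrable (fun s => f ((k + 1 : ℕ) * T / n) * g s) volume
        (k * T / n) ((k + 1 : ℕ) * T / n) := Continuous.intervalIntegrable (by fun_prop) _ _
      exact IntervalIntegrable.congr (by rw [Set.uIoc_of_le (hle k)]; exact heq k) h1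
    have := intervalIntegral.sum_integral_adjacent_intervals
      (a := fun k : ℕ => (k * T / n : ℝ)) hint
    simp only [Nat.cast_zero, zero_mul, zero_div] at this
    rw [mul_div_cancel_left₀ _ hn'.ne'] at this
    rw [← this]
    refine Finset.sum_congr rfl fun k _ => ?_
    rw [← intervalIntegral.integral_const_mul]
    refine intervalIntegral.integral_congr_ae (.of_forall fun s hs => ?_)
    rw [Set.uIoc_of_le (hle k)] at hs
    exact (heq k hs).symm
  refine Tendsto.congr' hsum ?_
  have hcle : ∀ᶠ n : ℕ in atTop, ∀ s ∈ Set.Icc 0 T, s ≤ c n s ∧ c n s ≤ T ∧ c n s ≤ s + T / n := by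
    filter_upwards [eventually_gt_atTop 0] with n hn s hs
    have hn' : (0 : ℝ) < n := by exact_mod_cast hn
    simp only [hc]
    refine ⟨?_, ?_, ?_⟩
    · rw [le_div_iff₀ hn', ← div_le_iff₀ hT]
      exact Nat.le_ceil _
    · rw [div_le_iff₀ hn', mul_comm T]
      gcongr
      refine Nat.ceil_le.2 ?_
      rw [div_le_iff₀ hT, mul_comm]
      gcongr
      exact hs.2
    · have h0 : 0 ≤ s * n / T := div_nonneg (mul_nonneg hs.1 hn'.le) hT.le
      have h1 := (Nat.ceil_lt_add_one h0).le
      calc (⌈s * n / T⌉₊ : ℝ) * T / n ≤ (s * n / T + 1) * T / n := by gcongr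
        _ = s + T / n := by field_simp
  refine intervalIntegral.tendsto_integral_filter_of_dominated_convergence
    (fun s => C * ‖g s‖) ?_ ?_ (Continuous.intervalIntegrable (by fun_prop) _ _) ?_
  · refine .of_forall fun n => Measurable.aestronglyMeasurable ?_
    have h1 : Measurable fun m : ℕ => f ((m : ℝ) * T / n) := measurable_from_top
    exact (h1.comp (Nat.measurable_ceil.comp (by fun_prop : Measurable fun s : ℝ => s * n / T))).mul
      hg.measurable
  · filter_upwards [hcle] with n hn
    refine .of_forall fun s hs => ?_
    rw [Set.uIoc_of_le hT.le] at hs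
    obtain ⟨h1, h2, -⟩ := hn s ⟨hs.1.le, hs.2⟩
    rw [norm_mul]
    gcongr
    exact hC _ ⟨hs.1.le.trans h1, h2⟩
  · refine .of_forall fun s hs => ?_
    rw [Set.uIoc_of_le hT.le] at hs
    have hs' : s ∈ Set.Icc 0 T := ⟨hs.1.le, hs.2⟩
    refine Tendsto.mul_const _ ((hf s hs').tendsto.comp ?_)
    refine tendsto_nhdsWithin_iff.2 ⟨?_, hcle.mono fun n hn => (hn s hs').1⟩
    refine tendsto_of_tendsto_of_tendsto_of_le_of_le' tendsto_const_nhds ?_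
      (hcle.mono fun n hn => (hn s hs').1) (hcle.mono fun n hn => (hn s hs').2.2)
    simpa using (tendsto_const_div_atTop_nhds_zero_nat T).const_add s

theorem sum_mul_sub_eq (e y : ℕ → ℝ) (n : ℕ) :
    ∑ k ∈ Finset.range n, e k * (y (k + 1) - y k) =
      e n * y n - e 0 * y 0 + ∑ k ∈ Finset.range n, y (k + 1) * (e k - e (k + 1)) := by
  induction n with
  | zero => simp
  | succ n ih =>
    rw [Finset.sum_range_succ, Finset.sum_range_succ, ih]
    ring

/-- The Riemann–Stieltjes sums of a càdlàg path converge to the integral defined by parts. -/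
theorem tendsto_sum_expIntegral {y : ℝ≥0 → ℝ}
    (hy : ∀ t : ℝ≥0, ContinuousWithinAt y (Set.Ici t) t ∧ ∃ l : ℝ, Tendsto y (𝓝[<] t) (𝓝 l))
    {T : ℝ≥0} (hT : 0 < T) :
    Tendsto (fun n : ℕ => ∑ k ∈ Finset.range n, Real.exp (-(k * T / n)) *
      (y ((k + 1 : ℕ) * T / n) - y (k * T / n))) atTop (𝓝 (expIntegral y T)) := by
  have hT' : (0 : ℝ) < T := hT
  obtain ⟨C, hC⟩ := exists_bound_of_cadlag hy T
  have h1 := tendsto_sum_mul_integral (f := fun s => y s.toNNReal) (g := fun s => Real.exp (-s))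
    hT' (by fun_prop) (C := C)
    (fun s hs => hC _ (by simpa using Real.toNNReal_le_toNNReal hs.2)) (fun s hs => by
      refine ContinuousWithinAt.comp (t := Set.Ici s.toNNReal) (hy _).1
        continuous_real_toNNReal.continuousWithinAt fun r hr => Real.toNNReal_le_toNNReal hr)
  refine (h1.const_add (Real.exp (-(T : ℝ)) * y T - y 0)).congr' ?_
  filter_upwards [eventually_gt_atTop 0] with n hn
  have hn' : (n : ℝ) ≠ 0 := by exact_mod_cast hn.ne'
  have hn'' : (n : ℝ≥0) ≠ 0 := by exact_mod_cast hn.ne'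
  -- Summation by parts moves the differences onto the exponential, where each is the integral of
  -- e^{-s} over a cell.
  rw [sum_mul_sub_eq (fun k => Real.exp (-(k * T / n))) (fun k => y (k * T / n)) n]
  congr 1
  · rw [mul_div_cancel_left₀ _ hn', mul_div_cancel_left₀ _ hn'']
    simp
  · refine Finset.sum_congr rfl fun k _ => ?_
    congr 1
    · congr 1
      rw [← NNReal.coe_inj, Real.coe_toNNReal _ (by positivity)]
      push_cast
      rfl
    · rw [intervalIntegral.integral_comp_neg (fun s => Real.exp s), integral_exp]

theorem tendsto_riemannSum {f : ℝ → ℂ} (hf : Continuous f) {T : ℝ} (hT : 0 < T) :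
    Tendsto (fun n : ℕ => ∑ k ∈ Finset.range n, ((T / n : ℝ) : ℂ) * f (k * T / n)) atTop
      (𝓝 (∫ s in (0 : ℝ)..T, f s)) := by
  obtain ⟨C, hC⟩ := (isCompact_Icc (a := 0) (b := T)).exists_bound_of_continuousOn hf.continuousOn
  have h1 := tendsto_sum_mul_integral (g := fun _ => (1 : ℂ)) hT continuous_const hC
    fun s _ => hf.continuousWithinAt
  simp only [mul_one] at h1
  -- Correction from right-endpoint sums to the left-endpoint sums that the increments of the
  -- process produce; the difference telescopes.
  have h2 : Tendsto (fun n : ℕ => ((T / n : ℝ) : ℂ) * (f 0 - f T)) atTop (𝓝 0) := by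
    have := (Complex.continuous_ofReal.tendsto 0).comp (tendsto_const_div_atTop_nhds_zero_nat T)
    simpa using this.mul_const (f 0 - f T)
  have h3 := h1.add h2
  rw [add_zero] at h3
  refine h3.congr' ?_
  filter_upwards [eventually_gt_atTop 0] with n hn
  have hn' : (n : ℝ) ≠ 0 := by exact_mod_cast hn.ne'
  have h4 := Finset.sum_range_sub' (fun k : ℕ => f (k * T / n)) n
  rw [mul_div_cancel_left₀ _ hn', Nat.cast_zero, zero_mul, zero_div] at h4
  rw [← h4, Finset.mul_sum, ← Finset.sum_add_distrib]
  refine Finset.sum_congr rfl fun k _ => ?_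
  rw [intervalIntegral.integral_const]
  have h5 : ((k + 1 : ℕ) * T / n - k * T / n : ℝ) = T / n := by
    push_cast
    ring
  rw [h5, Complex.real_smul]
  ring

/-! ### The characteristic function of the exponential integral. -/

namespace IsLevyProcess

variable {Ω : Type*} [MeasurableSpace Ω] {Y : ℝ≥0 → Ω → ℝ} {P : Measure Ω}

theorem charFun_map_sum (hY : IsLevyProcess Y P) {η : ℝ → ℂ}
    (hη : ∀ (t : ℝ≥0) u, charFun (P.map (Y t)) u = Complex.exp (t * η u)) (e : ℕ → ℝ) (T : ℝ≥0)
    (n : ℕ) (u : ℝ) :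
    charFun (P.map fun ω => ∑ k ∈ Finset.range n, e k *
      (Y ((k + 1 : ℕ) * T / n) ω - Y (k * T / n) ω)) u =
      Complex.exp (∑ k ∈ Finset.range n, ((T / n : ℝ) : ℂ) * η (e k * u)) := by
  have hmono : Monotone fun k : ℕ => (k * T / n : ℝ≥0) := fun a b hab => by
    have : (a : ℝ≥0) ≤ b := by exact_mod_cast hab
    simp only
    gcongr
  have hind := (hY.indep_increments.nat hmono).comp (fun k x => e k * x)
    (fun k => measurable_const_mul (e k))
  have hmeas : ∀ k : ℕ, Measurable fun ω => Y ((k + 1 : ℕ) * T / n) ω - Y (k * T / n) ω :=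
    fun k => (hY.measurable _).sub (hY.measurable _)
  have h1 := iIndepFun.charFun_map_fun_finsetSum_eq_prod (P := P) (s := Finset.range n)
    (X := fun k ω => e k * (Y ((k + 1 : ℕ) * T / n) ω - Y (k * T / n) ω))
    (fun k _ => ((hmeas k).const_mul (e k)).aemeasurable) (hind.restrict _)
  rw [h1, Finset.prod_apply, Complex.exp_sum]
  refine Finset.prod_congr rfl fun k _ => ?_
  rw [charFun_map_mul_comp (hmeas k).aemeasurable]
  have h2 : ((k + 1 : ℕ) * T / n : ℝ≥0) = k * T / n + T / n := by
    push_cast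
    ring
  rw [h2, hY.charFun_map_sub, hη]
  push_cast
  rfl

/-- The sums converge almost surely, hence so do their characteristic functions; by independence of
increments these are exponentials of Riemann sums for s ↦ η(e^{-s}u). -/
theorem charFun_map_expIntegral [IsProbabilityMeasure P] (hY : IsLevyProcess Y P) {η : ℝ → ℂ} (hηc : Continuous η)
    (hη : ∀ (t : ℝ≥0) u, charFun (P.map (Y t)) u = Complex.exp (t * η u)) {T : ℝ≥0} (hT : 0 < T)
    (hm : AEMeasurable (fun ω => expIntegral (fun s => Y s ω) T) P) (u : ℝ) :
    charFun (P.map fun ω => expIntegral (fun s => Y s ω) T) u =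
      Complex.exp (∫ s in (0 : ℝ)..T, η (Real.exp (-s) * u)) := by
  have h1 : Tendsto (fun n : ℕ => charFun (P.map fun ω => ∑ k ∈ Finset.range n,
      Real.exp (-(k * T / n)) * (Y ((k + 1 : ℕ) * T / n) ω - Y (k * T / n) ω)) u) atTop
      (𝓝 (charFun (P.map fun ω => expIntegral (fun s => Y s ω) T) u)) := by
    have hS : ∀ n : ℕ, Measurable fun ω => ∑ k ∈ Finset.range n,
        Real.exp (-(k * T / n)) * (Y ((k + 1 : ℕ) * T / n) ω - Y (k * T / n) ω) := fun n =>
      Finset.measurable_sum _ fun k _ => ((hY.measurable _).sub (hY.measurable _)).const_mul _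
    have hmap : ∀ f : Ω → ℝ, AEMeasurable f P →
        charFun (P.map f) u = ∫ ω, Complex.exp (u * f ω * Complex.I) ∂P := fun f hf => by
      rw [charFun_apply_real, integral_map hf (Measurable.aestronglyMeasurable (by fun_prop))]
    rw [hmap _ hm]
    simp_rw [fun n => hmap _ (hS n).aemeasurable]
    refine tendsto_integral_filter_of_dominated_convergence (fun _ => 1) ?_ ?_
      (integrable_const _) ?_
    · refine .of_forall fun n => Measurable.aestronglyMeasurable ?_
      have := hS n
      fun_prop
    · refine .of_forall fun t => .of_forall fun ω => ?_
      rw [← Complex.ofReal_mul, Complex.norm_exp_ofReal_mul_I]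
    · filter_upwards [hY.cadlag] with ω hω
      have h2 := tendsto_sum_expIntegral hω hT
      have h3 : Continuous fun x : ℝ => Complex.exp (u * x * Complex.I) := by fun_prop
      exact (h3.tendsto _).comp h2
  refine tendsto_nhds_unique h1 ?_
  simp_rw [hY.charFun_map_sum hη]
  have h4 := tendsto_riemannSum (f := fun s => η (Real.exp (-s) * u)) (by fun_prop)
    (show (0 : ℝ) < T from hT)
  exact (Complex.continuous_exp.tendsto _).comp h4

end IsLevyProcess

theorem continuousOn_div_ofReal {η : ℝ → ℂ} (hη : Continuous η) {s : Set ℝ}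
    (hs : ∀ v ∈ s, v ≠ 0) : ContinuousOn (fun v : ℝ => η v / v) s :=
  hη.continuousOn.div (by fun_prop) fun v hv => by exact_mod_cast hs v hv

theorem integral_comp_exp_neg_mul {η : ℝ → ℂ} (hη : Continuous η) {u : ℝ} (hu : u ≠ 0) (T : ℝ) :
    ∫ s in (0 : ℝ)..T, η (Real.exp (-s) * u) = ∫ v in (Real.exp (-T) * u)..u, η v / v := by
  have hd : ∀ s ∈ Set.uIcc 0 T,
      HasDerivAt (fun s => Real.exp (-s) * u) (-(Real.exp (-s) * u)) s := fun s _ =>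
    ((hasDerivAt_id s).neg.exp.mul_const u).congr_deriv (by simp)
  have h1 := intervalIntegral.integral_deriv_smul_comp' (g := fun v : ℝ => η v / v) hd
    (by fun_prop) (continuousOn_div_ofReal hη (by
      rintro _ ⟨s, _, rfl⟩
      exact mul_ne_zero (Real.exp_ne_zero _) hu))
  rw [intervalIntegral.integral_symm u]
  simp only [neg_zero, Real.exp_zero, one_mul] at h1
  rw [← h1, ← intervalIntegral.integral_neg]
  refine intervalIntegral.integral_congr fun s _ => ?_
  have h2 : ((Real.exp (-s) * u : ℝ) : ℂ) ≠ 0 := by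
    exact_mod_cast mul_ne_zero (Real.exp_ne_zero _) hu
  simp only [Function.comp, Complex.real_smul, Complex.ofReal_neg]
  rw [neg_mul, neg_neg, mul_div_cancel₀ _ h2]

theorem tendsto_exp_neg_mul_nnreal (u : ℝ) :
    Tendsto (fun T : ℝ≥0 => Real.exp (-(T : ℝ)) * u) atTop (𝓝 0) := by
  simpa using (Real.tendsto_exp_neg_atTop_nhds_zero.comp
    (NNReal.tendsto_coe_atTop.2 tendsto_id)).mul_const u

/-! ### The log moment of Y(1) and the formula for φ. -/

section

variable {Ω' Ω : Type*} [MeasurableSpace Ω'] [MeasurableSpace Ω]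
  {P' : Measure Ω'} [IsProbabilityMeasure P'] {P : Measure Ω} [IsProbabilityMeasure P]
  {X : Ω' → ℝ} {Y : ℝ≥0 → Ω → ℝ}

theorem HasRandomIntegralRepresentation.tendsto_exp_integral
    (hX : HasRandomIntegralRepresentation X P' Y P) {η : ℝ → ℂ} (hηc : Continuous η)
    (hη : ∀ (t : ℝ≥0) u, charFun (P.map (Y t)) u = Complex.exp (t * η u)) {u : ℝ} (hu : u ≠ 0) :
    Tendsto (fun T : ℝ≥0 => Complex.exp (∫ v in (Real.exp (-T) * u)..u, η v / v)) atTop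
      (𝓝 (charFun (P'.map X) u)) := by
  have h1 := (ProbabilityMeasure.tendsto_iff_forall_integral_rclike_tendsto ℂ).1 hX.tendsto.tendsto
  have h2 := h1 (BoundedContinuousFunction.innerProbChar u)
  simp only [ProbabilityMeasure.coe_mk, ← charFun_eq_integral_innerProbChar] at h2
  refine h2.congr' ?_
  filter_upwards [eventually_gt_atTop 0] with T hT
  rw [hX.levy.charFun_map_expIntegral hηc hη hT (hX.tendsto.forall_aemeasurable T),
    integral_comp_exp_neg_mul hηc hu]

theorem HasRandomIntegralRepresentation.integrable_log
    (hX : HasRandomIntegralRepresentation X P' Y P) {η : ℝ → ℂ} (hηc : Continuous η)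
    (hη : ∀ (t : ℝ≥0) u, charFun (P.map (Y t)) u = Complex.exp (t * η u)) :
    Integrable (fun x => Real.log (1 + |x|)) (P.map (Y 1)) := by
  have : IsProbabilityMeasure (P.map (Y 1)) :=
    Measure.isProbabilityMeasure_map (hX.levy.measurable 1).aemeasurable
  have : IsProbabilityMeasure (P'.map X) :=
    Measure.isProbabilityMeasure_map hX.tendsto.aemeasurable_limit
  have hη1 : ∀ u, charFun (P.map (Y 1)) u = Complex.exp (η u) := fun u => by simp [hη 1 u]
  have hre : ∀ u, (η u).re ≤ 0 := by
    intro u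
    have h1 := norm_charFun_le_one (μ := P.map (Y 1)) u
    rwa [hη1, Complex.norm_exp, Real.exp_le_one_iff] at h1
  obtain ⟨ε, hε, hne⟩ : ∃ ε : ℝ, 0 < ε ∧ charFun (P'.map X) ε ≠ 0 := by
    have h1 : ∀ᶠ u in 𝓝 (0 : ℝ), charFun (P'.map X) u ≠ 0 :=
      continuous_charFun.continuousAt.eventually_ne (by simp)
    obtain ⟨ε, h2, h3⟩ := ((h1.filter_mono nhdsWithin_le_nhds).and
      (self_mem_nhdsWithin (s := Set.Ioi (0 : ℝ)))).exists
    exact ⟨ε, h3, h2⟩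
  -- As Re η ≤ 0, it is enough to bound the integrals over (e^{-T}ε, ε]. Their exponentials tend to
  -- c = |φ(ε)| > 0, so they eventually exceed log(c/2).
  have hint : IntegrableOn (fun v => (η v).re / v) (Set.Ioc 0 ε) := by
    have hcont : ∀ T : ℝ≥0, ContinuousOn (fun v : ℝ => η v / v)
        (Set.uIcc (Real.exp (-(T : ℝ)) * ε) ε) := by
      intro T
      refine continuousOn_div_ofReal hηc fun v hv => ?_
      exact ((lt_min (by positivity) hε).trans_le hv.1).ne'
    have hle : ∀ T : ℝ≥0, Real.exp (-(T : ℝ)) * ε ≤ ε := fun T =>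
      mul_le_of_le_one_left hε.le (Real.exp_le_one_iff.2 (by simp))
    have hdiv : ∀ v : ℝ, (η v / v).re = (η v).re / v := fun v => Complex.div_ofReal_re _ _
    have hlim := (hX.tendsto_exp_integral hηc hη hε.ne').norm
    simp_rw [Complex.norm_exp] at hlim
    set c := ‖charFun (P'.map X) ε‖
    have hc : 0 < c := norm_pos_iff.2 hne
    refine integrableOn_Ioc_of_intervalIntegral_norm_bounded_left (l := atTop)
      (a := fun T : ℝ≥0 => Real.exp (-(T : ℝ)) * ε) (I := -Real.log (c / 2)) (fun T => ?_)
      (tendsto_exp_neg_mul_nnreal ε) ?_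
    · have h1 : IntegrableOn (fun v : ℝ => (η v / v).re)
          (Set.uIcc (Real.exp (-(T : ℝ)) * ε) ε) :=
        (Complex.continuous_re.comp_continuousOn (hcont T)).integrableOn_uIcc
      rw [Set.uIcc_of_le (hle T)] at h1
      refine (h1.mono_set Set.Ioc_subset_Icc_self).congr (.of_forall fun v => ?_)
      exact hdiv v
    · filter_upwards [hlim.eventually_const_lt (half_lt_self hc)] with T hT
      rw [← Real.log_lt_iff_lt_exp (by positivity)] at hT
      have h2 := Complex.reCLM.intervalIntegral_comp_comm
        ((hcont T).intervalIntegrable (μ := volume))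
      simp only [Complex.reCLM_apply, hdiv] at h2
      rw [← h2, intervalIntegral.integral_of_le (hle T)] at hT
      have h3 : ∫ v in Set.Ioc (Real.exp (-(T : ℝ)) * ε) ε, ‖(η v).re / v‖ =
          -∫ v in Set.Ioc (Real.exp (-(T : ℝ)) * ε) ε, (η v).re / v := by
        rw [← integral_neg]
        refine setIntegral_congr_fun measurableSet_Ioc fun v hv => ?_
        have hv0 : 0 < v := lt_trans (by positivity) hv.1
        exact Real.norm_of_nonpos (div_nonpos_of_nonpos_of_nonneg (hre v) hv0.le)
      rw [h3]
      linarith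
  refine integrable_log_one_add_abs_of_charFun hε ?_
  refine Integrable.mono' (hint.norm.const_mul 2)
    (Measurable.aestronglyMeasurable (by have := measurable_charFun (μ := P.map (Y 1)); fun_prop)) ?_
  filter_upwards [ae_restrict_mem measurableSet_Ioc] with v hv
  have hv0 : 0 < v := hv.1
  have h1 := norm_charFun_le_one (μ := P.map (Y 1)) v
  have h2 : 0 ≤ 1 - ‖charFun (P.map (Y 1)) v‖ ^ 2 := by
    nlinarith [norm_nonneg (charFun (P.map (Y 1)) v)]
  rw [Real.norm_of_nonneg (div_nonneg h2 hv0.le),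
    Real.norm_of_nonpos (div_nonpos_of_nonpos_of_nonneg (hre v) hv0.le), ← neg_div,
    ← mul_div_assoc]
  gcongr
  rw [hη1, Complex.norm_exp, ← Real.exp_nat_mul]
  -- 1 - e^x ≤ -x with x = 2 Re η(v), where e^x is the squared modulus of the characteristic
  -- function.
  have := Real.add_one_le_exp ((2 : ℕ) * (η v).re)
  push_cast at this ⊢
  linarith

/-- Integrability at 0 makes the primitive of η(v)/v continuous there, so the lower limit e^{-T}u
may be sent to 0. -/
theorem HasRandomIntegralRepresentation.charFun_eq
    (hX : HasRandomIntegralRepresentation X P' Y P) {η : ℝ → ℂ} (hηc : Continuous η)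
    (hη : ∀ (t : ℝ≥0) u, charFun (P.map (Y t)) u = Complex.exp (t * η u))
    (hint : ∀ T, IntervalIntegrable (fun v : ℝ => η v / v) volume 0 T) (u : ℝ) :
    charFun (P'.map X) u = Complex.exp (∫ v in (0 : ℝ)..u, η v / v) := by
  have : IsProbabilityMeasure (P'.map X) :=
    Measure.isProbabilityMeasure_map hX.tendsto.aemeasurable_limit
  rcases eq_or_ne u 0 with rfl | hu
  · simp
  have h1 := hX.tendsto_exp_integral hηc hη hu
  have hint' : ∀ a b, IntervalIntegrable (fun v : ℝ => η v / v) volume a b := fun a b =>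
    (hint a).symm.trans (hint b)
  refine tendsto_nhds_unique h1 ((Complex.continuous_exp.tendsto _).comp ?_)
  have h2 := ((intervalIntegral.continuous_primitive hint' 0).tendsto 0).comp
    (tendsto_exp_neg_mul_nnreal u)
  have h3 := h2.const_sub (∫ v in (0 : ℝ)..u, η v / v)
  rw [intervalIntegral.integral_same, sub_zero] at h3
  refine h3.congr fun T => ?_
  exact intervalIntegral.integral_interval_sub_left (hint' _ _) (hint' _ _)

end

/-! ### The inversion formula. -/

theorem im_exp_mul_charFun_div {μ : Measure ℝ} [IsProbabilityMeasure μ] (a : ℝ) {t : ℝ}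
    (ht : t ≠ 0) :
    (Complex.exp (-(Complex.I * t * a)) * charFun μ t).im / t =
      ∫ x, (x - a) * Real.sinc (t * (x - a)) ∂μ := by
  have hint : Integrable (fun x : ℝ => Complex.exp ((t * (x - a) : ℝ) * Complex.I)) μ :=
    Integrable.of_bound (Measurable.aestronglyMeasurable (by fun_prop)) 1
      (.of_forall fun x => by rw [Complex.norm_exp_ofReal_mul_I])
  have h1 : Complex.exp (-(Complex.I * t * a)) * charFun μ t =
      ∫ x : ℝ, Complex.exp ((t * (x - a) : ℝ) * Complex.I) ∂μ := by
    rw [charFun_apply_real, ← integral_const_mul]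
    refine integral_congr_ae (.of_forall fun x => ?_)
    simp only
    rw [← Complex.exp_add]
    congr 1
    push_cast
    ring
  have h2 := integral_im hint
  simp only [RCLike.im_to_complex] at h2
  rw [h1, ← h2, ← integral_div]
  refine integral_congr_ae (.of_forall fun x => ?_)
  simp only
  rw [Complex.exp_ofReal_mul_I_im]
  rcases eq_or_ne (x - a) 0 with h | h
  · simp [h]
  · rw [Real.sinc_of_ne_zero (mul_ne_zero ht h)]
    field_simp

/-- For b < a the distribution function at b misses the atom at a; let b increase to a. -/
theorem measureReal_singleton_eq_zero_of_continuousAt {μ : Measure ℝ} [IsFiniteMeasure μ] {a : ℝ}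
    (h : ContinuousAt (fun x => μ.real (Set.Iic x)) a) : μ.real {a} = 0 := by
  have h1 : ∀ b ∈ Set.Iio a, μ.real (Set.Iic b) ≤ μ.real (Set.Iic a) - μ.real {a} := by
    intro b hb
    have h2 : Disjoint (Set.Iic b) {a} := by
      rw [Set.disjoint_singleton_right]
      exact not_le.2 (Set.mem_Iio.1 hb)
    rw [le_sub_iff_add_le, ← measureReal_union h2 (measurableSet_singleton a)]
    refine measureReal_mono (Set.union_subset (Set.Iic_subset_Iic.2 (le_of_lt hb)) ?_)
    simp
  have h3 := le_of_tendsto (h.tendsto.mono_left nhdsWithin_le_nhds)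
    (eventually_of_mem self_mem_nhdsWithin h1)
  have := measureReal_nonneg (μ := μ) (s := {a})
  linarith

theorem proposition1 {Ω' Ω : Type*} [MeasurableSpace Ω'] [MeasurableSpace Ω]
    (P' : Measure Ω') [IsProbabilityMeasure P'] (P : Measure Ω) [IsProbabilityMeasure P]
    (X : Ω' → ℝ) (Y : ℝ≥0 → Ω → ℝ)
    (hX : HasRandomIntegralRepresentation X P' Y P)
    (φ : ℝ → ℂ) (hφ : ∀ t : ℝ, φ t = ∫ ω, Complex.exp (Complex.I * t * X ω) ∂P') :
    (∀ t : ℝ, φ t ≠ 0) ∧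
    (∀ t : ℝ, t ≠ 0 → DifferentiableAt ℝ φ t) ∧
    (∀ a T : ℝ, 0 < T → IntervalIntegrable (inversionIntegrand φ a) volume 0 T) ∧
    ∀ a : ℝ, ContinuousAt (backgroundDrivingDistributionFunction Y P) a →
      Tendsto (fun T : ℝ => 1 / 2 - 1 / Real.pi * ∫ t in (0 : ℝ)..T, inversionIntegrand φ a t)
        atTop (𝓝 (backgroundDrivingDistributionFunction Y P a)) := by
  obtain ⟨η, hηc, hη0, hη⟩ := hX.levy.exists_exponent
  have hY1 := hX.levy.measurable 1
  set μ := P.map (Y 1) with hμ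
  have : IsProbabilityMeasure μ := Measure.isProbabilityMeasure_map hY1.aemeasurable
  have hη1 : ∀ u, charFun μ u = Complex.exp (η u) := fun u => by simp [hμ, hη 1 u]
  have hlog : Integrable (fun x => Real.log (1 + |x|)) μ := hX.integrable_log hηc hη
  have hint := intervalIntegrable_exponent_div hηc hη0 hη1 hlog
  have hφ' : φ = fun u => Complex.exp (∫ v in (0 : ℝ)..u, η v / v) := by
    funext u
    rw [← hX.charFun_eq hηc hη hint u, hφ, charFun_apply_real,
      integral_map hX.tendsto.aemeasurable_limit (Measurable.aestronglyMeasurable (by fun_prop))]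
    refine integral_congr_ae (.of_forall fun ω => ?_)
    simp only
    congr 1
    ring
  have hne : ∀ t, φ t ≠ 0 := fun t => by
    rw [hφ']
    exact Complex.exp_ne_zero _
  -- The fundamental theorem of calculus needs η(v)/v continuous at t, which excludes t = 0.
  have hderiv : ∀ t : ℝ, t ≠ 0 → HasDerivAt φ (φ t * (η t / t)) t := by
    intro t ht
    have h1 : HasDerivAt (fun u : ℝ => ∫ v in (0 : ℝ)..u, η v / v) (η t / t) t :=
      intervalIntegral.integral_hasDerivAt_right (hint t)
        (hηc.measurable.div (by fun_prop)).stronglyMeasurable.stronglyMeasurableAtFilter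
        (hηc.continuousAt.div (by fun_prop) (by exact_mod_cast ht))
    rw [hφ']
    exact h1.cexp
  -- Here tφ'(t)/φ(t) = η(t), so the integrand becomes the Gil-Pelaez integrand of Y(1) - a.
  have hinv : ∀ (a t : ℝ), t ≠ 0 → inversionIntegrand φ a t =
      ∫ x, (x - a) * Real.sinc (t * (x - a)) ∂μ := by
    intro a t ht
    have ht' : (t : ℂ) ≠ 0 := by exact_mod_cast ht
    rw [← im_exp_mul_charFun_div a ht, hη1, ← Complex.exp_add, inversionIntegrand,
      (hderiv t ht).deriv, mul_div_cancel_left₀ _ (hne t), mul_div_cancel₀ _ ht']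
  have hloga : ∀ a : ℝ, Integrable (fun x => Real.log (1 + |x - a|)) μ := by
    intro a
    refine Integrable.mono' (hlog.add (integrable_const (Real.log (1 + |-a|))))
      (Measurable.aestronglyMeasurable (by fun_prop)) (.of_forall fun x => ?_)
    rw [Real.norm_of_nonneg (log_one_add_abs_nonneg _)]
    have := log_one_add_abs_le_add (x - a) (-a)
    rwa [sub_neg_eq_add, sub_add_cancel] at this
  have hmeas : ∀ a : ℝ, Measurable fun x : ℝ => x - a := fun a => by fun_prop
  refine ⟨hne, fun t ht => (hderiv t ht).differentiableAt, fun a T hT => ?_, fun a ha => ?_⟩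
  · refine IntervalIntegrable.congr (fun t ht => ?_)
      (intervalIntegrable_integral_mul_sinc (hmeas a) (hloga a) hT.le)
    rw [Set.uIoc_of_le hT.le] at ht
    exact (hinv a t ht.1.ne').symm
  · have hG : backgroundDrivingDistributionFunction Y P = fun x => μ.real (Set.Iic x) := by
      funext x
      rw [hμ, map_measureReal_apply hY1 measurableSet_Iic]
      rfl
    rw [hG] at ha ⊢
    have h0 := measureReal_singleton_eq_zero_of_continuousAt ha
    have h1 := tendsto_integral_integral_mul_sinc (hmeas a) (hloga a)
      (by simpa [sub_eq_zero] using h0)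
    simp only [sub_nonpos] at h1
    refine h1.congr' ?_
    filter_upwards [eventually_ge_atTop 0] with T hT
    congr 2
    refine intervalIntegral.integral_congr_ae (.of_forall fun t ht => ?_)
    rw [Set.uIoc_of_le hT] at ht
    exact (hinv a t ht.1.ne').symm
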